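/- Let $\mathcal Z$ be a measurable space, $n\ge 0$, $\alpha\in(0,1)$, and let $s:\mathcal Z\to\mathbb R_+$ be a measurable conformity score. A (fuzzy) prediction set is a jointly measurable map $D:\mathcal Z^n\times\mathcal Z\to[0,1]$, where $D(z^n,z)$ is the degree of exclusion of $z$ after observing $z^n$; an ordinary prediction set $C^{z^n}\subseteq\mathcal Z$ is the case $D(z^n,z)=\mathbb I\{z\notin C^{z^n}\}$. It is valid at level $\alpha$ if $\mathrm E^P[D(Z^n,Z_{n+1})]\le\alpha$ for every exchangeable law $P$ of $Z^{n+1}=(Z_1,\dots,Z_{n+1})$; for an ordinary set this says $P(Z_{n+1}\in C^{Z^n})\ge 1-\alpha$. Given a $\sigma$-finite measure $\mu$ on $\mathcal Z$, its expected $\mu$-size under the true law $P_*$ is $\mathrm E^{P_*^{Z^n}}\big[\int(1-D(Z^n,z))\,d\mu(z)\big]$, which for an ordinary set is $\mathrm E^{P_*^{Z^n}}[\mu(C^{Z^n})]$. For $z^n$ and $z$ let $L$ and $T$ be the numbers of entries of $(z_1,\dots,z_n,z)$ whose score is $<s(z)$ and $=s(z)$, respectively. Classical conformal prediction with score $s$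 at exact level $\alpha$ is $$D_s(z^n,z)=\min\{1,\max\{0,(\alpha(n+1)-L)/T\}\}:$$ it excludes $z$ if the conformal p-value $(L+T)/(n+1)$ is at most $\alpha$, includes $z$ if $L/(n+1)\ge\alpha$, and treats the boundary tie group so that the average degree of exclusion over the entries is $\alpha$. Its non-randomized version is $C_s^{z^n}=\{z:(L+T)/(n+1)>\alpha\}$. Then $D_s$ and $C_s$ are valid at level $\alpha$. Moreover, let $\mu$ be any $\sigma$-finite measure and $P_*^{Z^{n+1}}$ any i.i.d. law with $P_*^{Z_{n+1}}\ll\mu$ such that $$s=m\!\left(\frac{dP_*^{Z_{n+1}}}{d\mu}\right)\quad\mu\text{-a.e.}$$ for some strictly increasing $m:\mathbb R_+\to\mathbb R_+$. Then $D_s$ has the smallest expected $\mu$-size among all fuzzy, and hence among all ordinary, prediction sets that are valid at level $\alpha$. If in addition $\alpha(n+1)$ is an integer and $s(Z_1)$ has no atoms under $P_*$, then the ordinary conformal set $C_s$ itself has the smallest expected $\mu$-size among all of them. -/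

import Mathlib

open MeasureTheory
open scoped NNReal ENNReal

namespace Conformal

/-- A law on `Z^(n+1)` is exchangeable if it is invariant under all permutations of the entries. -/
def IsExchangeable {Z : Type*} [MeasurableSpace Z] {n : ℕ} (P : Measure (Fin (n + 1) → Z)) : Prop :=
  ∀ σ : Equiv.Perm (Fin (n + 1)), P.map (fun z i => z (σ i)) = P

/-- A (binary) prediction set: a function of the observations `z₁, …, zₙ`, whose value is the set
of points `z` that are included. -/
abbrev PredSet (n : ℕ) (Z : Type*) := (Fin n → Z) → Set Z

/-- A fuzzy prediction set: `D zn z ∈ [0, 1]` is the degree of exclusion of the point `z` after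
observing `zn` (`0` is full inclusion, `1` is full exclusion). -/
abbrev FuzzyPredSet (n : ℕ) (Z : Type*) := (Fin n → Z) → Z → unitInterval

/-- Level `α` validity for the exchangeable model: `P (Z_{n+1} ∈ C(Zⁿ)) ≥ 1 - α` for every
exchangeable law `P` on `Z^(n+1)`. -/
structure PredSet.IsValid {Z : Type*} [MeasurableSpace Z] {n : ℕ} (α : ℝ) (C : PredSet n Z) :
    Prop where
  measurableSet : MeasurableSet {x : (Fin n → Z) × Z | x.2 ∈ C x.1}
  coverage : ∀ P : Measure (Fin (n + 1) → Z), IsProbabilityMeasure P → IsExchangeable P →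
    1 - α ≤ P.real {z | z (Fin.last n) ∈ C (fun i => z i.castSucc)}

/-- Level `α` validity for the exchangeable model of a fuzzy prediction set: under every
exchangeable law on `Z^(n+1)` the expected degree of exclusion of `Z_{n+1}` is at most `α`. -/
structure FuzzyPredSet.IsValid {Z : Type*} [MeasurableSpace Z] {n : ℕ} (α : ℝ)
    (D : FuzzyPredSet n Z) : Prop where
  measurable : Measurable (fun x : (Fin n → Z) × Z => D x.1 x.2)
  coverage : ∀ P : Measure (Fin (n + 1) → Z), IsProbabilityMeasure P → IsExchangeable P →
    ∫ z, (D (fun i => z i.castSucc) (z (Fin.last n)) : ℝ) ∂P ≤ α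

/-- The expected `μ`-size `E[μ(C(Zⁿ))]`, where `Zⁿ` has law `ν`. -/
noncomputable def PredSet.expectedSize {Z : Type*} [MeasurableSpace Z] {n : ℕ} (μ : Measure Z)
    (ν : Measure (Fin n → Z)) (C : PredSet n Z) : ℝ≥0∞ :=
  ∫⁻ zn, μ (C zn) ∂ν

/-- The expected `μ`-size `E[∫ (1 - D(Zⁿ, z)) dμ(z)]` of a fuzzy prediction set, where `Zⁿ` has
law `ν`. It is the expected size of the randomized set that excludes `z` with probability
`D(Zⁿ, z)`. -/
noncomputable def FuzzyPredSet.expectedSize {Z : Type*} [MeasurableSpace Z] {n : ℕ} (μ : Measure Z)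
    (ν : Measure (Fin n → Z)) (D : FuzzyPredSet n Z) : ℝ≥0∞ :=
  ∫⁻ zn, ∫⁻ z, ENNReal.ofReal (1 - (D zn z : ℝ)) ∂μ ∂ν

/-- The number of entries of `(z₁, …, zₙ, z)` whose conformity score is smaller than that of `z`. -/
noncomputable def numBelow {Z : Type*} {n : ℕ} (s : Z → ℝ≥0) (zn : Fin n → Z) (z : Z) : ℕ :=
  (Finset.univ.filter fun i => s (zn i) < s z).card

/-- The number of entries of `(z₁, …, zₙ, z)` with the same conformity score as `z`
(`z` itself is one of them). -/
noncomputable def numTied {Z : Type*} {n : ℕ} (s : Z → ℝ≥0) (zn : Fin n → Z) (z : Z) : ℕ :=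
  (Finset.univ.filter fun i => s (zn i) = s z).card + 1

/-- The conformal p-value of `z`: the fraction of the entries of `(z₁, …, zₙ, z)` whose conformity
score is at most that of `z`. -/
noncomputable def pValue {Z : Type*} {n : ℕ} (s : Z → ℝ≥0) (zn : Fin n → Z) (z : Z) : ℝ :=
  (((Finset.univ.filter fun i => s (zn i) ≤ s z).card : ℝ) + 1) / ((n : ℝ) + 1)

/-- Classical conformal prediction without randomization: `z` is included iff its p-value
exceeds `α`. -/
def conformalSet {Z : Type*} {n : ℕ} (α : ℝ) (s : Z → ℝ≥0) : PredSet n Z :=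
  fun zn => {z | α < pValue s zn z}

/-- Classical conformal prediction with exact level `α`. With `L = numBelow` and `T = numTied`,
the degree of exclusion of `z` is `(α (n + 1) - L) / T` clamped to `[0, 1]`. So `z` is fully
excluded if `(L + T) / (n + 1) ≤ α` (that is, if its p-value is at most `α`), fully included if
`L / (n + 1) ≥ α`, and the one group of tied scores that straddles the level is excluded to the
degree that makes the average degree of exclusion over the entries of `(z₁, …, zₙ, z)` equal to
`α`. It is the probability that the smoothed p-value `(L + U T) / (n + 1)`, with `U` uniform on
`[0, 1]`, is at most `α`. -/
noncomputable def conformalFuzzy {Z : Type*} {n : ℕ} (α : ℝ) (s : Z → ℝ≥0) : FuzzyPredSet n Z :=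
  fun zn z => Set.projIcc (0 : ℝ) 1 zero_le_one
    ((α * ((n : ℝ) + 1) - (numBelow s zn z : ℝ)) / (numTied s zn z : ℝ))

end Conformal

namespace Conformal

/-! Everything is decided orbit by orbit, an orbit being the permutations of a fixed vector of `n +
1` entries. The uniform law on an orbit is exchangeable, so a valid `D` has average exclusion at
most `α` on every orbit (`FuzzyPredSet.IsValid.sum_perm_le`). Conformal prediction averages exactly
`α` there (`sum_perm_exclusion`), which also gives its validity.

With `f = dP/dμ`, the expected size is an integral over the `(n + 1)`-fold power of `μ` in which the
candidate alone carries no factor `f`. Symmetrizing (`FuzzyPredSet.card_mul_expectedSize`) gives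
every arrangement with candidate `z j` the weight `∏ i ≠ j, f (z i)`, which is antitone in `f (z
j)`. Minimizing size on an orbit is thus a Neyman–Pearson problem: the exclusion budget belongs on
the largest weights, that is, on the lowest densities and hence the lowest scores
(`sum_one_sub_exclusion_mul_le`).

If `α (n + 1)` is an integer and scores have no atoms, the fractional tie group almost surely
disappears, so the ordinary set has the same size. -/

/-- The degree of exclusion of the entry `j` of a finite family of scores `a`, when a total
degree of exclusion `β` is spent on the entries in increasing order of their scores. -/
noncomputable def exclusion {ι : Type*} [Fintype ι] (β : ℝ) (a : ι → ℝ≥0) (j : ι) : ℝ :=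
  max 0 (min 1 ((β - ((Finset.univ.filter fun i => a i < a j).card : ℝ)) /
    ((Finset.univ.filter fun i => a i = a j).card : ℝ)))

/-! ### Spending an exclusion budget on a finite family; Neyman–Pearson over permutations. -/

section Exclusion

variable {ι : Type*} [Fintype ι]

theorem exclusion_comp_perm (β : ℝ) (a : ι → ℝ≥0) (σ : Equiv.Perm ι) (j : ι) :
    exclusion β (fun i => a (σ i)) j = exclusion β a (σ j) := by
  have h : ∀ p : ι → Prop, ∀ [DecidablePred p],
      (Finset.univ.filter fun i => p (σ i)).card = (Finset.univ.filter p).card := by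
    intro p _
    refine Finset.card_bij (fun i _ => σ i) (by simp) (fun _ _ _ _ h => σ.injective h) ?_
    intro b hb
    exact ⟨σ.symm b, by simpa using hb, by simp⟩
  unfold exclusion
  rw [h fun i => a i < a (σ j), h fun i => a i = a (σ j)]

theorem card_tied_pos (a : ι → ℝ≥0) (j : ι) :
    0 < ((Finset.univ.filter fun i => a i = a j).card : ℝ) := by
  exact_mod_cast Finset.card_pos.2 ⟨j, by simp⟩

theorem card_le_eq_add (a : ι → ℝ≥0) (j : ι) :
    (Finset.univ.filter fun i => a i ≤ a j).card =
      (Finset.univ.filter fun i => a i < a j).card +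
        (Finset.univ.filter fun i => a i = a j).card := by
  classical
  rw [← Finset.card_union_of_disjoint]
  · congr 1
    ext i
    simp [le_iff_lt_or_eq]
  · rw [Finset.disjoint_filter]
    intro i _ h
    exact h.ne

theorem exclusion_eq_one {β : ℝ} {a : ι → ℝ≥0} {j : ι}
    (h : ((Finset.univ.filter fun i => a i ≤ a j).card : ℝ) ≤ β) : exclusion β a j = 1 := by
  rw [card_le_eq_add, Nat.cast_add] at h
  have : 1 ≤ (β - ((Finset.univ.filter fun i => a i < a j).card : ℝ)) /
      ((Finset.univ.filter fun i => a i = a j).card : ℝ) := by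
    rw [le_div_iff₀ (card_tied_pos a j)]
    linarith
  simp [exclusion, this]

theorem exclusion_eq_zero {β : ℝ} {a : ι → ℝ≥0} {j : ι}
    (h : β ≤ ((Finset.univ.filter fun i => a i < a j).card : ℝ)) : exclusion β a j = 0 := by
  have : (β - ((Finset.univ.filter fun i => a i < a j).card : ℝ)) /
      ((Finset.univ.filter fun i => a i = a j).card : ℝ) ≤ 0 :=
    div_nonpos_of_nonpos_of_nonneg (by linarith) (card_tied_pos a j).le
  exact max_eq_left ((min_le_right _ _).trans this)

/-- There is a threshold entry: entries with smaller scores are excluded, entries with larger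
scores are included, and the total degree of exclusion is `β`. -/
theorem exists_threshold {β : ℝ} (h₀ : 0 < β) (h₁ : β < Fintype.card ι) (a : ι → ℝ≥0) :
    ∃ t, (∀ j, a j < a t → exclusion β a j = 1) ∧ (∀ j, a t < a j → exclusion β a j = 0) ∧
      ∑ j, exclusion β a j = β := by
  classical
  have hne : Nonempty ι := by
    rw [← Fintype.card_pos_iff]
    exact_mod_cast h₀.trans h₁
  -- The entries that receive a positive degree; the threshold is one with the largest score.
  let S := Finset.univ.filter fun j => ((Finset.univ.filter fun i => a i < a j).card : ℝ) < β
  have hS : S.Nonempty := by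
    obtain ⟨j, -, hj⟩ := Finset.exists_min_image Finset.univ a Finset.univ_nonempty
    refine ⟨j, ?_⟩
    have : (Finset.univ.filter fun i => a i < a j) = ∅ := by
      rw [Finset.filter_eq_empty_iff]
      exact fun i hi => not_lt.2 (hj i hi)
    simp [S, this, h₀]
  obtain ⟨t, htS, ht⟩ := Finset.exists_max_image S a hS
  have htS' : ((Finset.univ.filter fun i => a i < a t).card : ℝ) < β := by simpa [S] using htS
  have hlt : ∀ j, a j < a t → exclusion β a j = 1 := by
    intro j hj
    refine exclusion_eq_one (le_trans ?_ htS'.le)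
    exact_mod_cast Finset.card_le_card
      (Finset.monotone_filter_right _ fun i _ hi => lt_of_le_of_lt hi hj)
  have hgt : ∀ j, a t < a j → exclusion β a j = 0 := by
    intro j hj
    refine exclusion_eq_zero (not_lt.1 fun h => ?_)
    exact absurd (ht j (by simpa [S] using h)) (not_le.2 hj)
  refine ⟨t, hlt, hgt, ?_⟩
  -- Otherwise the lowest score above `a t` would also have fewer than `β` entries below it, against
  -- the maximality of `t`.
  have hle : β ≤ ((Finset.univ.filter fun i => a i ≤ a t).card : ℝ) := by
    by_contra! hcon
    let U := Finset.univ.filter fun i => a t < a i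
    have hU : U.Nonempty := by
      rw [Finset.nonempty_iff_ne_empty]
      intro hU
      rw [Finset.filter_eq_empty_iff] at hU
      have : (Finset.univ.filter fun i => a i ≤ a t) = Finset.univ := by
        rw [Finset.filter_eq_self]
        exact fun i hi => not_lt.1 (hU hi)
      rw [this, Finset.card_univ] at hcon
      linarith
    obtain ⟨u, huU, hu⟩ := Finset.exists_min_image U a hU
    have huU' : a t < a u := by simpa [U] using huU
    have : u ∈ S := by
      simp only [S, Finset.mem_filter, Finset.mem_univ, true_and]
      refine lt_of_le_of_lt ?_ hcon
      refine Nat.cast_le.2 (Finset.card_le_card (Finset.monotone_filter_right _ fun i _ hi => ?_))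
      by_contra! h
      exact absurd (hu i (by simpa [U] using h)) (not_le.2 hi)
    exact absurd (ht u this) (not_le.2 huU')
  rw [card_le_eq_add, Nat.cast_add] at hle
  have hT := card_tied_pos a t
  have hval : exclusion β a t = (β - ((Finset.univ.filter fun i => a i < a t).card : ℝ)) /
      ((Finset.univ.filter fun i => a i = a t).card : ℝ) := by
    rw [exclusion, min_eq_right, max_eq_right]
    · exact div_nonneg (by linarith) hT.le
    · rw [div_le_one hT]
      linarith
  -- The tied entries share the degree of `t`, so the total is `L + T * ((β - L) / T) = β`.
  have heq : ∀ j, exclusion β a j = (if a j < a t then 1 else 0) +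
      (if a j = a t then exclusion β a t else 0) := by
    intro j
    rcases lt_trichotomy (a j) (a t) with h | h | h
    · simp [h, h.ne, hlt j h]
    · simp [h, exclusion]
    · simp [h.ne', h.not_gt, hgt j h]
  rw [Finset.sum_congr rfl fun j _ => heq j, Finset.sum_add_distrib, Finset.sum_boole,
    ← Finset.sum_filter, Finset.sum_const, nsmul_eq_mul, hval]
  rw [mul_div_cancel₀ _ hT.ne', add_sub_cancel]

/-- A uniformly random permutation sends `k` to a uniformly distributed index. -/
theorem sum_perm_apply [DecidableEq ι] (F : ι → ℝ) (k : ι) :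
    (Fintype.card ι : ℝ) * ∑ σ : Equiv.Perm ι, F (σ k) =
      (Fintype.card (Equiv.Perm ι) : ℝ) * ∑ i, F i := by
  have h : ∀ i, ∑ σ : Equiv.Perm ι, F (σ i) = ∑ σ : Equiv.Perm ι, F (σ k) := by
    intro i
    rw [← Equiv.sum_comp (Equiv.mulRight (Equiv.swap k i))]
    simp
  calc (Fintype.card ι : ℝ) * ∑ σ : Equiv.Perm ι, F (σ k)
      = ∑ i, ∑ σ : Equiv.Perm ι, F (σ i) := by simp [h]
    _ = ∑ σ : Equiv.Perm ι, ∑ i, F (σ i) := Finset.sum_comm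
    _ = ∑ σ : Equiv.Perm ι, ∑ i, F i := by simp [Equiv.sum_comp]
    _ = _ := by simp

theorem sum_perm_exclusion [DecidableEq ι] {α : ℝ} (hα₀ : 0 < α) (hα₁ : α < 1) (a : ι → ℝ≥0)
    (k : ι) : ∑ σ : Equiv.Perm ι, exclusion (α * Fintype.card ι) a (σ k) =
      Fintype.card (Equiv.Perm ι) * α := by
  have hc : (0 : ℝ) < Fintype.card ι := by exact_mod_cast Fintype.card_pos_iff.2 ⟨k⟩
  obtain ⟨t, -, -, ht⟩ := exists_threshold (mul_pos hα₀ hc) (by nlinarith) a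
  have := sum_perm_apply (exclusion (α * Fintype.card ι) a) k
  rw [ht] at this
  apply mul_left_cancel₀ hc.ne'
  linarith

/-- Deleting an entry leaves a product that is antitone in the deleted factor. -/
theorem prod_erase_le_prod_erase [DecidableEq ι] {f : ι → ℝ} (hf : ∀ i, 0 ≤ f i) {j t : ι}
    (h : f j ≤ f t) :
    ∏ i ∈ Finset.univ.erase t, f i ≤ ∏ i ∈ Finset.univ.erase j, f i := by
  rcases eq_or_ne j t with rfl | hjt
  · exact le_rfl
  -- The two products differ only in `f j` versus `f t`; nothing is divided by, so zeros of `f` are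
  -- harmless.
  rw [← Finset.mul_prod_erase (Finset.univ.erase t) f (a := j) (by simp [hjt]),
    ← Finset.mul_prod_erase (Finset.univ.erase j) f (a := t) (by simp [hjt.symm]),
    Finset.erase_right_comm]
  exact mul_le_mul_of_nonneg_right h (Finset.prod_nonneg fun i _ => hf i)

/-- Neyman–Pearson inequality over the permutations of a finite family. -/
theorem sum_one_sub_exclusion_mul_le [DecidableEq ι] {α : ℝ} (hα₀ : 0 < α) (hα₁ : α < 1)
    {a : ι → ℝ≥0} {w : ι → ℝ} (hw : ∀ i, 0 ≤ w i) (hlt : ∀ i j, a i ≤ a j → w j ≤ w i)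
    (k : ι) {d : Equiv.Perm ι → ℝ} (hd₀ : ∀ σ, 0 ≤ d σ) (hd₁ : ∀ σ, d σ ≤ 1)
    (hd : ∑ σ, d σ ≤ Fintype.card (Equiv.Perm ι) * α) :
    ∑ σ : Equiv.Perm ι, (1 - exclusion (α * Fintype.card ι) a (σ k)) * w (σ k) ≤
      ∑ σ, (1 - d σ) * w (σ k) := by
  have hc : (0 : ℝ) < Fintype.card ι := by exact_mod_cast Fintype.card_pos_iff.2 ⟨k⟩
  obtain ⟨t, h1, h0, -⟩ := exists_threshold (mul_pos hα₀ hc) (by nlinarith) a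
  have hsum := sum_perm_exclusion hα₀ hα₁ a k
  set e := exclusion (α * Fintype.card ι) a
  -- `w t` is the Lagrange multiplier. Entries tied with `t` have weight exactly `w t`, so their
  -- fractional degree does not matter.
  have hterm : ∀ σ : Equiv.Perm ι, 0 ≤ (e (σ k) - d σ) * (w (σ k) - w t) := by
    intro σ
    rcases lt_trichotomy (a (σ k)) (a t) with h | h | h
    · rw [h1 _ h]
      exact mul_nonneg (sub_nonneg.2 (hd₁ σ)) (sub_nonneg.2 (hlt _ _ h.le))
    · rw [le_antisymm (hlt _ _ h.ge) (hlt _ _ h.le), sub_self, mul_zero]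
    · rw [h0 _ h]
      exact mul_nonneg_of_nonpos_of_nonpos (by linarith [hd₀ σ]) (sub_nonpos.2 (hlt _ _ h.le))
  have hs := Finset.sum_nonneg fun σ (_ : σ ∈ Finset.univ) => hterm σ
  have hexp : ∑ σ : Equiv.Perm ι, (e (σ k) - d σ) * (w (σ k) - w t) =
      ∑ σ, (1 - d σ) * w (σ k) - ∑ σ : Equiv.Perm ι, (1 - e (σ k)) * w (σ k) -
        (∑ σ : Equiv.Perm ι, e (σ k) - ∑ σ, d σ) * w t := by
    rw [← Finset.sum_sub_distrib, ← Finset.sum_sub_distrib, Finset.sum_mul,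
      ← Finset.sum_sub_distrib]
    exact Finset.sum_congr rfl fun σ _ => by ring
  rw [hexp, hsum] at hs
  -- Budget left unspent by `d` can only increase its size, since `w t ≥ 0`.
  have := mul_nonneg (sub_nonneg.2 hd) (hw t)
  linarith

end Exclusion

/-! ### Conformal prediction as `exclusion`, validity, and orbit laws. -/

section Score

variable {Z : Type*} {n : ℕ}

theorem card_filter_castSucc_add (p : Fin (n + 1) → Prop) [DecidablePred p] :
    (Finset.univ.filter p).card =
      (Finset.univ.filter fun i : Fin n => p i.castSucc).card +
        if p (Fin.last n) then 1 else 0 := by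
  simp only [Finset.card_filter, Fin.sum_univ_castSucc]

/-- The `+ 1` in `numTied` is the last entry, tied with itself. -/
theorem coe_conformalFuzzy (α : ℝ) (s : Z → ℝ≥0) (z : Fin (n + 1) → Z) :
    (conformalFuzzy α s (fun i => z i.castSucc) (z (Fin.last n)) : ℝ) =
      exclusion (α * Fintype.card (Fin (n + 1))) (fun i => s (z i)) (Fin.last n) := by
  rw [conformalFuzzy, Set.coe_projIcc, exclusion, card_filter_castSucc_add,
    card_filter_castSucc_add fun i => s (z i) = s (z (Fin.last n))]
  simp [numBelow, numTied]

theorem coe_conformalFuzzy_perm (α : ℝ) (s : Z → ℝ≥0) (z : Fin (n + 1) → Z)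
    (σ : Equiv.Perm (Fin (n + 1))) :
    (conformalFuzzy α s (fun i : Fin n => z (σ i.castSucc)) (z (σ (Fin.last n))) : ℝ) =
      exclusion (α * Fintype.card (Fin (n + 1))) (fun i => s (z i)) (σ (Fin.last n)) := by
  rw [coe_conformalFuzzy α s fun i => z (σ i), exclusion_comp_perm _ fun i => s (z i)]

/-- Hence the fuzzy set dominates the exclusion indicator of `conformalSet`, which inherits its
validity. -/
theorem coe_conformalFuzzy_eq_one {α : ℝ} {s : Z → ℝ≥0} {zn : Fin n → Z} {z : Z}
    (h : z ∉ conformalSet α s zn) : (conformalFuzzy α s zn z : ℝ) = 1 := by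
  have key := coe_conformalFuzzy α s (Fin.snoc zn z : Fin (n + 1) → Z)
  simp only [Fin.snoc_castSucc, Fin.snoc_last] at key
  rw [key]
  apply exclusion_eq_one
  rw [card_filter_castSucc_add]
  simp only [conformalSet, pValue, Set.mem_ofPred_eq, not_lt] at h
  rw [div_le_iff₀ (by positivity)] at h
  simpa using h

/-- The indicator of exclusion of a binary prediction set. -/
noncomputable def PredSet.toFuzzy (C : PredSet n Z) : FuzzyPredSet n Z :=
  open Classical in fun zn z => if z ∈ C zn then 0 else 1

/-- Without ties, and if `α (n + 1)` is an integer, the conformal set needs no randomization. -/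
theorem toFuzzy_conformalSet_of_no_ties {α : ℝ} {s : Z → ℝ≥0} {k : ℕ}
    (hk : α * ((n : ℝ) + 1) = k) {zn : Fin n → Z} {z : Z} (h : ∀ i, s (zn i) ≠ s z) :
    (conformalSet α s : PredSet n Z).toFuzzy zn z = conformalFuzzy α s zn z := by
  by_cases hz : z ∈ conformalSet α s zn
  · have hT : numTied s zn z = 1 := by simp [numTied, h]
    have hL : (k : ℝ) ≤ numBelow s zn z := by
      have hle : (Finset.univ.filter fun i => s (zn i) ≤ s z) =
          Finset.univ.filter fun i => s (zn i) < s z :=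
        Finset.filter_congr fun i _ => ⟨fun h' => lt_of_le_of_ne h' (h i), le_of_lt⟩
      have hz' : α < pValue s zn z := hz
      rw [pValue, lt_div_iff₀ (by positivity), hk, hle] at hz'
      -- Integrality of `k` turns the strict bound by `L + 1` into `k ≤ L`.
      have : k < numBelow s zn z + 1 := by exact_mod_cast hz'
      exact_mod_cast Nat.lt_succ_iff.1 this
    rw [PredSet.toFuzzy, if_pos hz, conformalFuzzy, hT, hk, Nat.cast_one, div_one,
      Set.projIcc_of_le_left _ (sub_nonpos.2 hL)]
    rfl
  · rw [PredSet.toFuzzy, if_neg hz]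
    exact Subtype.ext (coe_conformalFuzzy_eq_one hz).symm

variable [MeasurableSpace Z]

theorem measurable_card_filter {Ω ι : Type*} [MeasurableSpace Ω] [Fintype ι]
    (p : ι → Ω → Prop) [∀ x, DecidablePred fun i => p i x] (hp : ∀ i, MeasurableSet {x | p i x}) :
    Measurable fun x => ((Finset.univ.filter fun i => p i x).card : ℝ) := by
  classical
  have : (fun x => ((Finset.univ.filter fun i => p i x).card : ℝ)) =
      fun x => ∑ i, Set.indicator {x | p i x} (fun _ => (1 : ℝ)) x := by
    ext x
    rw [Finset.card_filter]
    push_cast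
    exact Finset.sum_congr rfl fun i _ => by simp [Set.indicator_apply]
  rw [this]
  exact Finset.measurable_sum _ fun i _ => measurable_const.indicator (hp i)

theorem measurable_conformalFuzzy (α : ℝ) {s : Z → ℝ≥0} (hs : Measurable s) :
    Measurable fun x : (Fin n → Z) × Z => conformalFuzzy α s x.1 x.2 := by
  have h1 : Measurable fun x : (Fin n → Z) × Z => (numBelow s x.1 x.2 : ℝ) :=
    measurable_card_filter _ fun i => measurableSet_lt (by fun_prop) (by fun_prop)
  have h2 : Measurable fun x : (Fin n → Z) × Z => (numTied s x.1 x.2 : ℝ) := by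
    simp only [numTied, Nat.cast_add, Nat.cast_one]
    exact (measurable_card_filter _ fun i => measurableSet_eq_fun (by fun_prop)
      (by fun_prop)).add_const 1
  exact continuous_projIcc.measurable.comp ((h1.const_sub _).div h2)

theorem measurableSet_conformalSet (α : ℝ) {s : Z → ℝ≥0} (hs : Measurable s) :
    MeasurableSet {x : (Fin n → Z) × Z | x.2 ∈ conformalSet α s x.1} := by
  have h : Measurable fun x : (Fin n → Z) × Z => pValue s x.1 x.2 :=
    ((measurable_card_filter _ fun i => measurableSet_le (by fun_prop)
      (by fun_prop)).add_const 1).div_const _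
  exact measurableSet_lt measurable_const h

theorem measurable_initLast :
    Measurable fun z : Fin (n + 1) → Z => ((fun i : Fin n => z i.castSucc), z (Fin.last n)) := by
  fun_prop

theorem measurable_permute (σ : Equiv.Perm (Fin (n + 1))) :
    Measurable fun (z : Fin (n + 1) → Z) i => z (σ i) := by
  fun_prop

theorem FuzzyPredSet.measurable_coe {D : FuzzyPredSet n Z}
    (hD : Measurable fun x : (Fin n → Z) × Z => D x.1 x.2) :
    Measurable fun z : Fin (n + 1) → Z =>
      (D (fun i => z i.castSucc) (z (Fin.last n)) : ℝ) :=
  measurable_subtype_coe.comp (hD.comp measurable_initLast)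

theorem FuzzyPredSet.integrable_coe {D : FuzzyPredSet n Z}
    (hD : Measurable fun x : (Fin n → Z) × Z => D x.1 x.2) (P : Measure (Fin (n + 1) → Z))
    [IsFiniteMeasure P] :
    Integrable (fun z => (D (fun i => z i.castSucc) (z (Fin.last n)) : ℝ)) P := by
  refine Integrable.of_bound (measurable_coe hD).aestronglyMeasurable 1 (.of_forall fun z => ?_)
  rw [Real.norm_of_nonneg (unitInterval.nonneg _)]
  exact unitInterval.le_one _

/-- Under an exchangeable law, an expectation can be symmetrized. -/
theorem IsExchangeable.integral_sum_perm {P : Measure (Fin (n + 1) → Z)} (hP : IsExchangeable P)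
    {g : (Fin (n + 1) → Z) → ℝ} (hg : Measurable g) (hi : Integrable g P) :
    ∫ z, ∑ σ : Equiv.Perm (Fin (n + 1)), g (fun i => z (σ i)) ∂P =
      Fintype.card (Equiv.Perm (Fin (n + 1))) * ∫ z, g z ∂P := by
  have hmp : ∀ σ : Equiv.Perm (Fin (n + 1)),
      MeasurePreserving (fun (z : Fin (n + 1) → Z) i => z (σ i)) P P :=
    fun σ => ⟨measurable_permute σ, hP σ⟩
  have hint : ∀ σ : Equiv.Perm (Fin (n + 1)), Integrable (fun z => g fun i => z (σ i)) P :=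
    fun σ => (hmp σ).integrable_comp_of_integrable hi
  rw [integral_finsetSum _ fun σ _ => hint σ]
  have : ∀ σ : Equiv.Perm (Fin (n + 1)), ∫ z, g (fun i => z (σ i)) ∂P = ∫ z, g z ∂P := by
    intro σ
    conv_rhs => rw [← hP σ]
    rw [integral_map (measurable_permute σ).aemeasurable hg.aestronglyMeasurable]
  simp [this]

theorem isValid_conformalFuzzy {α : ℝ} (hα₀ : 0 < α) (hα₁ : α < 1) {s : Z → ℝ≥0}
    (hs : Measurable s) : (conformalFuzzy α s : FuzzyPredSet n Z).IsValid α := by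
  refine ⟨measurable_conformalFuzzy α hs, fun P _ hP => ?_⟩
  have hD := measurable_conformalFuzzy (n := n) α hs
  have h := hP.integral_sum_perm (FuzzyPredSet.measurable_coe hD)
    (FuzzyPredSet.integrable_coe hD P)
  -- The symmetrized integrand is constant, so the level is attained with equality.
  simp only [coe_conformalFuzzy_perm, sum_perm_exclusion hα₀ hα₁] at h
  rw [integral_const, probReal_univ, one_smul] at h
  refine le_of_eq (mul_left_cancel₀ ?_ h.symm)
  exact_mod_cast Fintype.card_ne_zero

theorem isValid_conformalSet {α : ℝ} (hα₀ : 0 < α) (hα₁ : α < 1) {s : Z → ℝ≥0}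
    (hs : Measurable s) : (conformalSet α s : PredSet n Z).IsValid α := by
  refine ⟨measurableSet_conformalSet α hs, fun P _ hP => ?_⟩
  have hval := (isValid_conformalFuzzy (n := n) hα₀ hα₁ hs).coverage P inferInstance hP
  set A := {z : Fin (n + 1) → Z |
    z (Fin.last n) ∈ conformalSet α s (fun i : Fin n => z i.castSucc)}
  have hm : MeasurableSet A := measurable_initLast (measurableSet_conformalSet α hs)
  have hpt : ∀ z, Aᶜ.indicator (fun _ => (1 : ℝ)) z ≤
      conformalFuzzy α s (fun i : Fin n => z i.castSucc) (z (Fin.last n)) := by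
    intro z
    by_cases hz : z ∈ A
    · rw [Set.indicator_of_notMem (by simpa using hz)]
      exact unitInterval.nonneg _
    · have hz' : z (Fin.last n) ∉ conformalSet α s (fun i : Fin n => z i.castSucc) := hz
      rw [Set.indicator_of_mem (by simpa using hz), coe_conformalFuzzy_eq_one hz']
  have hle : P.real Aᶜ ≤ α := by
    rw [← integral_indicator_one hm.compl]
    exact (integral_mono ((integrable_const 1).indicator hm.compl)
      (FuzzyPredSet.integrable_coe (measurable_conformalFuzzy α hs) P) hpt).trans hval
  rw [probReal_compl_eq_one_sub hm] at hle
  linarith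

/-- The law of a uniformly random permutation of a fixed vector. -/
noncomputable def orbitLaw (z : Fin (n + 1) → Z) : Measure (Fin (n + 1) → Z) :=
  (Fintype.card (Equiv.Perm (Fin (n + 1))) : ℝ≥0∞)⁻¹ •
    ∑ σ : Equiv.Perm (Fin (n + 1)), Measure.dirac fun i => z (σ i)

instance isProbabilityMeasure_orbitLaw (z : Fin (n + 1) → Z) :
    IsProbabilityMeasure (orbitLaw z) := by
  constructor
  rw [orbitLaw, Measure.smul_apply, Measure.finsetSum_apply]
  simp only [measure_univ, Finset.sum_const, Finset.card_univ, nsmul_eq_mul, mul_one, smul_eq_mul]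
  exact ENNReal.inv_mul_cancel (by simp) (by simp)

theorem isExchangeable_orbitLaw (z : Fin (n + 1) → Z) : IsExchangeable (orbitLaw z) := by
  intro τ
  rw [orbitLaw, Measure.map_smul, ← Measure.mapₗ_apply_of_measurable (measurable_permute τ),
    map_sum]
  congr 1
  simp only [Measure.mapₗ_apply_of_measurable (measurable_permute τ),
    Measure.map_dirac' (measurable_permute τ)]
  exact Equiv.sum_comp (Equiv.mulRight τ) fun σ => Measure.dirac fun i => z (σ i)

/-- A valid prediction set has average degree of exclusion at most `α` over the permutations of
every vector. -/
theorem FuzzyPredSet.IsValid.sum_perm_le {α : ℝ} {D : FuzzyPredSet n Z} (hD : D.IsValid α)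
    (z : Fin (n + 1) → Z) :
    ∑ σ : Equiv.Perm (Fin (n + 1)), (D (fun i => z (σ i.castSucc)) (z (σ (Fin.last n))) : ℝ) ≤
      Fintype.card (Equiv.Perm (Fin (n + 1))) * α := by
  have h := hD.coverage (orbitLaw z) inferInstance (isExchangeable_orbitLaw z)
  have hm := FuzzyPredSet.measurable_coe hD.measurable
  rw [orbitLaw, integral_smul_measure,
    integral_finsetSum_measure fun σ _ => FuzzyPredSet.integrable_coe hD.measurable _] at h
  -- The primed form uses measurability of the integrand; singletons of `Z` need not be measurable.
  simp only [integral_dirac' _ _ hm.stronglyMeasurable] at h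
  have hc : (0 : ℝ) < Fintype.card (Equiv.Perm (Fin (n + 1))) := by
    exact_mod_cast Fintype.card_pos
  rw [ENNReal.toReal_inv, ENNReal.toReal_natCast, smul_eq_mul, inv_mul_le_iff₀ hc] at h
  exact h

theorem PredSet.IsValid.toFuzzy {α : ℝ} {C : PredSet n Z} (hC : C.IsValid α) :
    C.toFuzzy.IsValid α := by
  classical
  refine ⟨Measurable.ite hC.measurableSet measurable_const measurable_const, fun P _ hP => ?_⟩
  have hm : MeasurableSet {z : Fin (n + 1) → Z |
      z (Fin.last n) ∈ C (fun i : Fin n => z i.castSucc)} :=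
    measurable_initLast hC.measurableSet
  have h := hC.coverage P inferInstance hP
  have : ∀ z : Fin (n + 1) → Z, (C.toFuzzy (fun i => z i.castSucc) (z (Fin.last n)) : ℝ) =
      Set.indicator {z : Fin (n + 1) → Z |
        z (Fin.last n) ∈ C (fun i : Fin n => z i.castSucc)}ᶜ 1 z := by
    intro z
    by_cases hz : z (Fin.last n) ∈ C (fun i : Fin n => z i.castSucc) <;>
      simp [PredSet.toFuzzy, hz]
  simp only [this]
  rw [integral_indicator_one hm.compl, probReal_compl_eq_one_sub hm]
  linarith

theorem PredSet.expectedSize_toFuzzy {C : PredSet n Z}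
    (hC : MeasurableSet {x : (Fin n → Z) × Z | x.2 ∈ C x.1}) (μ : Measure Z)
    (ν : Measure (Fin n → Z)) : C.toFuzzy.expectedSize μ ν = C.expectedSize μ ν := by
  classical
  refine lintegral_congr fun zn => ?_
  have hm : MeasurableSet (C zn) := measurable_prodMk_left hC
  rw [← lintegral_indicator_one hm]
  refine lintegral_congr fun z => ?_
  by_cases hz : z ∈ C zn <;> simp [PredSet.toFuzzy, hz]

end Score

/-! ### Expected size through densities, and optimality. -/

section Density

variable {Z : Type*} [MeasurableSpace Z] {n : ℕ}

theorem lintegral_pi_prod (μ : Measure Z) [SigmaFinite μ] :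
    ∀ {n : ℕ} (f : Fin n → Z → ℝ≥0∞), (∀ i, Measurable (f i)) →
      ∫⁻ z, ∏ i, f i (z i) ∂(Measure.pi fun _ : Fin n => μ) = ∏ i, ∫⁻ x, f i x ∂μ
  | 0, f, _ => by simp
  | n + 1, f, hf => by
    have hmp := (measurePreserving_piFinSuccAbove (fun _ : Fin (n + 1) => μ) 0).symm
    rw [← hmp.lintegral_comp_emb (MeasurableEquiv.measurableEmbedding _)]
    simp only [Fin.prod_univ_succ, MeasurableEquiv.piFinSuccAbove_symm_apply,
      Fin.insertNthEquiv_zero, Fin.consEquiv_apply, Fin.cons_zero, Fin.cons_succ]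
    have hprod : Measurable fun z : Fin n → Z => ∏ i, f i.succ (z i) :=
      Finset.measurable_prod _ fun i _ => (hf _).comp (measurable_pi_apply i)
    rw [lintegral_prod_mul (hf 0).aemeasurable hprod.aemeasurable,
      lintegral_pi_prod μ (fun i => f i.succ) fun i => hf _]

theorem pi_withDensity (μ : Measure Z) [SigmaFinite μ] {f : Z → ℝ≥0∞} (hf : Measurable f)
    [SigmaFinite (μ.withDensity f)] :
    (Measure.pi fun _ : Fin n => μ.withDensity f) =
      (Measure.pi fun _ : Fin n => μ).withDensity fun z => ∏ i, f (z i) := by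
  refine Measure.pi_eq fun t ht => ?_
  rw [withDensity_apply _ (MeasurableSet.univ_pi ht),
    ← lintegral_indicator (MeasurableSet.univ_pi ht)]
  have : ∀ z : Fin n → Z, (Set.univ.pi t).indicator (fun z => ∏ i, f (z i)) z =
      ∏ i, (t i).indicator f (z i) := by
    intro z
    by_cases hz : z ∈ Set.univ.pi t
    · rw [Set.indicator_of_mem hz]
      exact Finset.prod_congr rfl fun i _ => (Set.indicator_of_mem (hz i trivial) f).symm
    · rw [Set.indicator_of_notMem hz]
      simp only [Set.mem_pi, Set.mem_univ, true_imp_iff, not_forall] at hz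
      obtain ⟨i, hi⟩ := hz
      exact (Finset.prod_eq_zero (Finset.mem_univ i) (Set.indicator_of_notMem hi f)).symm
  simp only [this]
  rw [lintegral_pi_prod μ (fun i => (t i).indicator f) fun i => hf.indicator (ht i)]
  exact Finset.prod_congr rfl fun i _ => by
    rw [lintegral_indicator (ht i), withDensity_apply _ (ht i)]

theorem measurePreserving_permute (μ : Measure Z) [SigmaFinite μ]
    (σ : Equiv.Perm (Fin (n + 1))) :
    MeasurePreserving (fun (z : Fin (n + 1) → Z) i => z (σ i))
      (Measure.pi fun _ => μ) (Measure.pi fun _ => μ) := by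
  refine ⟨measurable_permute σ, (Measure.pi_eq fun t ht => ?_).symm⟩
  rw [Measure.map_apply (measurable_permute σ) (MeasurableSet.univ_pi ht)]
  have : (fun (z : Fin (n + 1) → Z) i => z (σ i)) ⁻¹' Set.univ.pi t =
      Set.univ.pi fun i => t (σ.symm i) := by
    ext z
    simp only [Set.mem_preimage, Set.mem_pi, Set.mem_univ, true_imp_iff]
    exact ⟨fun h i => by simpa using h (σ.symm i), fun h i => by simpa using h (σ i)⟩
  rw [this, Measure.pi_pi]
  exact Equiv.prod_comp σ.symm fun i => μ (t i)

/-- The joint law of the observations and the base measure, in terms of the density of an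
observation. -/
theorem lintegral_lintegral_pi_eq {μ P : Measure Z} [SigmaFinite μ] [IsProbabilityMeasure P]
    (hP : P ≪ μ) {h : (Fin n → Z) × Z → ℝ≥0∞} (hh : Measurable h) :
    ∫⁻ zn, ∫⁻ z, h (zn, z) ∂μ ∂(Measure.pi fun _ : Fin n => P) =
      ∫⁻ z, h (fun i => z i.castSucc, z (Fin.last n)) *
        ∏ i : Fin n, P.rnDeriv μ (z i.castSucc) ∂(Measure.pi fun _ : Fin (n + 1) => μ) := by
  have hf := Measure.measurable_rnDeriv P μ
  have hPi : (Measure.pi fun _ : Fin n => P) =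
      (Measure.pi fun _ : Fin n => μ).withDensity fun z => ∏ i, P.rnDeriv μ (z i) := by
    rw [← pi_withDensity μ hf]
    simp only [Measure.withDensity_rnDeriv_eq P μ hP]
  have hprod : Measurable fun z : Fin n → Z => ∏ i, P.rnDeriv μ (z i) :=
    Finset.measurable_prod _ fun i _ => hf.comp (measurable_pi_apply i)
  -- The last coordinate is the candidate, integrated against `μ` itself, hence without a density
  -- factor.
  have hmp := (measurePreserving_piFinSuccAbove (fun _ : Fin (n + 1) => μ) (Fin.last n)).symm
  rw [hPi, lintegral_withDensity_eq_lintegral_mul _ hprod hh.lintegral_prod_right',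
    ← hmp.lintegral_comp_emb (MeasurableEquiv.measurableEmbedding _)]
  simp only [MeasurableEquiv.piFinSuccAbove_symm_apply, Fin.insertNthEquiv_apply,
    Fin.insertNth_last', Fin.snoc_castSucc, Fin.snoc_last]
  rw [lintegral_prod_symm]
  · refine lintegral_congr fun zn => ?_
    have hzn : Measurable fun x => h (zn, x) := hh.comp measurable_prodMk_left
    rw [Pi.mul_apply, mul_comm, ← lintegral_mul_const _ hzn]
  · exact ((hh.comp measurable_swap).mul (hprod.comp measurable_snd)).aemeasurable

theorem FuzzyPredSet.measurable_inclusion {D : FuzzyPredSet n Z}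
    (hD : Measurable fun x : (Fin n → Z) × Z => D x.1 x.2) :
    Measurable fun x : (Fin n → Z) × Z => ENNReal.ofReal (1 - (D x.1 x.2 : ℝ)) :=
  ((measurable_subtype_coe.comp hD).const_sub 1).ennreal_ofReal

/-- The expected size, symmetrized over the permutations of the entries. -/
theorem FuzzyPredSet.card_mul_expectedSize {μ P : Measure Z} [SigmaFinite μ]
    [IsProbabilityMeasure P] (hP : P ≪ μ) {D : FuzzyPredSet n Z}
    (hD : Measurable fun x : (Fin n → Z) × Z => D x.1 x.2) :
    Fintype.card (Equiv.Perm (Fin (n + 1))) *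
        D.expectedSize μ (Measure.pi fun _ : Fin n => P) =
      ∫⁻ z, ∑ σ : Equiv.Perm (Fin (n + 1)),
        ENNReal.ofReal (1 - (D (fun i => z (σ i.castSucc)) (z (σ (Fin.last n))) : ℝ)) *
          ∏ i ∈ Finset.univ.erase (σ (Fin.last n)), P.rnDeriv μ (z i)
        ∂(Measure.pi fun _ : Fin (n + 1) => μ) := by
  have hf := Measure.measurable_rnDeriv P μ
  have hG := FuzzyPredSet.measurable_inclusion hD
  let g : (Fin (n + 1) → Z) → ℝ≥0∞ := fun z =>
    ENNReal.ofReal (1 - (D (fun i => z i.castSucc) (z (Fin.last n)) : ℝ)) *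
      ∏ i : Fin n, P.rnDeriv μ (z i.castSucc)
  have hg : Measurable g := (hG.comp measurable_initLast).mul
    (Finset.measurable_prod _ fun i _ => hf.comp (measurable_pi_apply _))
  -- The observations are all entries but `σ (Fin.last n)`, and their product ignores order, so the
  -- weight depends only on the candidate.
  have hterm : ∀ (z : Fin (n + 1) → Z) (σ : Equiv.Perm (Fin (n + 1))),
      ENNReal.ofReal (1 - (D (fun i => z (σ i.castSucc)) (z (σ (Fin.last n))) : ℝ)) *
        ∏ i ∈ Finset.univ.erase (σ (Fin.last n)), P.rnDeriv μ (z i) = g fun i => z (σ i) := by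
    intro z σ
    have hset : Finset.univ.erase (σ (Fin.last n)) =
        (Finset.univ : Finset (Fin n)).map (Fin.castSuccEmb.trans σ.toEmbedding) := by
      ext j
      simp only [Finset.mem_erase, Finset.mem_univ, and_true, Finset.mem_map, true_and]
      constructor
      · intro h
        obtain ⟨i, hi⟩ := Fin.exists_castSucc_eq.2
          fun h' : σ.symm j = Fin.last n => h (by simp [← h'])
        exact ⟨i, by simp [hi]⟩
      · rintro ⟨i, rfl⟩
        simp [(Fin.castSucc_lt_last i).ne]
    simp [g, hset]
  simp only [hterm]
  have hgσ : ∀ σ : Equiv.Perm (Fin (n + 1)), Measurable fun z : Fin (n + 1) → Z =>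
      g fun i => z (σ i) := fun σ => hg.comp (measurable_permute σ)
  rw [lintegral_finsetSum _ fun σ _ => hgσ σ]
  simp only [fun σ => (measurePreserving_permute μ σ).lintegral_comp hg]
  rw [Finset.sum_const, Finset.card_univ, nsmul_eq_mul]
  congr 1
  exact lintegral_lintegral_pi_eq hP hG

theorem expectedSize_conformalFuzzy_le {α : ℝ} (hα₀ : 0 < α) (hα₁ : α < 1) {s : Z → ℝ≥0}
    (hs : Measurable s) {μ P : Measure Z} [SigmaFinite μ] [IsProbabilityMeasure P] (hP : P ≪ μ)
    {m : ℝ≥0 → ℝ≥0} (hm : StrictMono m)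
    (hsm : ∀ᵐ z ∂μ, s z = m (P.rnDeriv μ z).toNNReal) {D : FuzzyPredSet n Z}
    (hD : D.IsValid α) :
    (conformalFuzzy α s : FuzzyPredSet n Z).expectedSize μ (Measure.pi fun _ : Fin n => P) ≤
      D.expectedSize μ (Measure.pi fun _ : Fin n => P) := by
  have hc₀ : (Fintype.card (Equiv.Perm (Fin (n + 1))) : ℝ≥0∞) ≠ 0 := by
    exact_mod_cast Fintype.card_ne_zero
  rw [← ENNReal.mul_le_mul_iff_right hc₀ (ENNReal.natCast_ne_top _),
    FuzzyPredSet.card_mul_expectedSize hP (measurable_conformalFuzzy α hs),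
    FuzzyPredSet.card_mul_expectedSize hP hD.measurable]
  -- Finiteness matters: `toNNReal` and `toReal` send `∞` to `0`, which would break the order of the
  -- densities.
  have hae : ∀ᵐ z ∂(Measure.pi fun _ : Fin (n + 1) => μ), ∀ i,
      s (z i) = m (P.rnDeriv μ (z i)).toNNReal ∧ P.rnDeriv μ (z i) < ∞ := by
    rw [ae_all_iff]
    intro i
    exact (Measure.tendsto_eval_ae_ae (μ := fun _ => μ) (i := i)).eventually
      (hsm.and (Measure.rnDeriv_lt_top P μ))
  refine lintegral_mono_ae (hae.mono fun z hz => ?_)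
  let f : Fin (n + 1) → ℝ := fun i => (P.rnDeriv μ (z i)).toReal
  have hf : ∀ i, 0 ≤ f i := fun i => ENNReal.toReal_nonneg
  let w : Fin (n + 1) → ℝ := fun j => ∏ i ∈ Finset.univ.erase j, f i
  have hw : ∀ j, 0 ≤ w j := fun j => Finset.prod_nonneg fun i _ => hf i
  have hconv : ∀ (d : Equiv.Perm (Fin (n + 1)) → unitInterval),
      ∑ σ, ENNReal.ofReal (1 - (d σ : ℝ)) *
        ∏ i ∈ Finset.univ.erase (σ (Fin.last n)), P.rnDeriv μ (z i) =
      ENNReal.ofReal (∑ σ, (1 - (d σ : ℝ)) * w (σ (Fin.last n))) := by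
    intro d
    have h0 : ∀ σ, 0 ≤ 1 - (d σ : ℝ) := fun σ => sub_nonneg.2 (unitInterval.le_one _)
    rw [ENNReal.ofReal_sum_of_nonneg fun σ _ => mul_nonneg (h0 σ) (hw _)]
    refine Finset.sum_congr rfl fun σ _ => ?_
    rw [ENNReal.ofReal_mul (h0 σ), ENNReal.ofReal_prod_of_nonneg fun i _ => hf i]
    congr 1
    exact Finset.prod_congr rfl fun i _ => (ENNReal.ofReal_toReal (hz i).2.ne).symm
  have hanti : ∀ i j, s (z i) ≤ s (z j) → w j ≤ w i := by
    intro i j hij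
    refine prod_erase_le_prod_erase hf ?_
    -- Strictness of `m` lets the order of scores be read back as the order of densities.
    rw [(hz i).1, (hz j).1, hm.le_iff_le] at hij
    exact_mod_cast hij
  rw [hconv fun σ => conformalFuzzy α s (fun i => z (σ i.castSucc)) (z (σ (Fin.last n))),
    hconv fun σ => D (fun i => z (σ i.castSucc)) (z (σ (Fin.last n)))]
  simp only [coe_conformalFuzzy_perm]
  exact ENNReal.ofReal_le_ofReal (sum_one_sub_exclusion_mul_le hα₀ hα₁ hw hanti (Fin.last n)
    (fun σ => unitInterval.nonneg _) (fun σ => unitInterval.le_one _) (hD.sum_perm_le z))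

theorem expectedSize_conformalSet {α : ℝ} {s : Z → ℝ≥0} (hs : Measurable s) {k : ℕ}
    (hk : α * ((n : ℝ) + 1) = k) {μ P : Measure Z} [SigmaFinite μ] [IsProbabilityMeasure P]
    (hP : ∀ c : ℝ≥0, P (s ⁻¹' {c}) = 0) :
    (conformalSet α s : PredSet n Z).expectedSize μ (Measure.pi fun _ : Fin n => P) =
      (conformalFuzzy α s : FuzzyPredSet n Z).expectedSize μ (Measure.pi fun _ : Fin n => P) := by
  classical
  have hC := measurableSet_conformalSet (n := n) α hs
  have hC' : Measurable fun x : (Fin n → Z) × Z =>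
      (conformalSet α s : PredSet n Z).toFuzzy x.1 x.2 :=
    Measurable.ite hC measurable_const measurable_const
  rw [← PredSet.expectedSize_toFuzzy hC, FuzzyPredSet.expectedSize, FuzzyPredSet.expectedSize]
  -- With the candidate fixed and the observations integrated first, ties are `P`-null for every
  -- `z`, although `μ` itself may charge level sets of `s`.
  conv_lhs =>
    rw [lintegral_lintegral_swap (FuzzyPredSet.measurable_inclusion hC').aemeasurable]
  conv_rhs =>
    rw [lintegral_lintegral_swap
      (FuzzyPredSet.measurable_inclusion (measurable_conformalFuzzy α hs)).aemeasurable]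
  refine lintegral_congr fun z => lintegral_congr_ae ?_
  have hae : ∀ᵐ zn ∂(Measure.pi fun _ : Fin n => P), ∀ i, s (zn i) ≠ s z := by
    rw [ae_all_iff]
    intro i
    refine (Measure.tendsto_eval_ae_ae (i := i)).eventually (p := fun x => s x ≠ s z) ?_
    rw [ae_iff]
    simpa using! hP (s z)
  filter_upwards [hae] with zn hzn
  rw [toFuzzy_conformalSet_of_no_ties hk hzn]

end Density

end Conformal

theorem mainTheorem5 {Z : Type*} [MeasurableSpace Z] (n : ℕ) (α : ℝ) (hα₀ : 0 < α) (hα₁ : α < 1)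
    (s : Z → ℝ≥0) (hs : Measurable s) :
    -- validity at level `α`, for every score
    (Conformal.conformalFuzzy α s : Conformal.FuzzyPredSet n Z).IsValid α ∧
    (Conformal.conformalSet α s : Conformal.PredSet n Z).IsValid α ∧
    -- optimality, for every `μ` and every true i.i.d. law for which `s` is an increasing function
    -- of the density of an observation
    ∀ (μ : Measure Z) (P : Measure Z), SigmaFinite μ → IsProbabilityMeasure P → P ≪ μ →
      ∀ m : ℝ≥0 → ℝ≥0, StrictMono m → (∀ᵐ z ∂μ, s z = m (P.rnDeriv μ z).toNNReal) →
        (∀ D : Conformal.FuzzyPredSet n Z, D.IsValid α →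
          (Conformal.conformalFuzzy α s : Conformal.FuzzyPredSet n Z).expectedSize μ
              (Measure.pi fun _ : Fin n => P) ≤
            D.expectedSize μ (Measure.pi fun _ : Fin n => P)) ∧
        (∀ C : Conformal.PredSet n Z, C.IsValid α →
          (Conformal.conformalFuzzy α s : Conformal.FuzzyPredSet n Z).expectedSize μ
              (Measure.pi fun _ : Fin n => P) ≤
            C.expectedSize μ (Measure.pi fun _ : Fin n => P)) ∧
        -- when no randomization is needed, the non-randomized conformal set is optimal
        ((∃ k : ℕ, α * ((n : ℝ) + 1) = k) → (∀ c : ℝ≥0, P (s ⁻¹' {c}) = 0) →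
          (∀ D : Conformal.FuzzyPredSet n Z, D.IsValid α →
            (Conformal.conformalSet α s : Conformal.PredSet n Z).expectedSize μ
                (Measure.pi fun _ : Fin n => P) ≤
              D.expectedSize μ (Measure.pi fun _ : Fin n => P)) ∧
          (∀ C : Conformal.PredSet n Z, C.IsValid α →
            (Conformal.conformalSet α s : Conformal.PredSet n Z).expectedSize μ
                (Measure.pi fun _ : Fin n => P) ≤
              C.expectedSize μ (Measure.pi fun _ : Fin n => P))) := by
  refine ⟨Conformal.isValid_conformalFuzzy hα₀ hα₁ hs, Conformal.isValid_conformalSet hα₀ hα₁ hs,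
    fun μ P _ _ hP m hm hsm => ?_⟩
  have hfuzzy : ∀ D : Conformal.FuzzyPredSet n Z, D.IsValid α →
      (Conformal.conformalFuzzy α s : Conformal.FuzzyPredSet n Z).expectedSize μ
          (Measure.pi fun _ : Fin n => P) ≤
        D.expectedSize μ (Measure.pi fun _ : Fin n => P) :=
    fun D hD => Conformal.expectedSize_conformalFuzzy_le hα₀ hα₁ hs hP hm hsm hD
  have hset : ∀ C : Conformal.PredSet n Z, C.IsValid α →
      (Conformal.conformalFuzzy α s : Conformal.FuzzyPredSet n Z).expectedSize μ
          (Measure.pi fun _ : Fin n => P) ≤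
        C.expectedSize μ (Measure.pi fun _ : Fin n => P) := fun C hC => by
    rw [← Conformal.PredSet.expectedSize_toFuzzy hC.measurableSet]
    exact hfuzzy _ hC.toFuzzy
  refine ⟨hfuzzy, hset, fun ⟨k, hk⟩ hatom => ?_⟩
  rw [Conformal.expectedSize_conformalSet hs hk hatom]
  exact ⟨hfuzzy, hset⟩
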